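/- Let $n,d,m,L\ge 1$ be integers with $m\ge d$, let $(\mathbf{x}_i,y_i)_{i=1}^n\subset\mathbb{R}^d\times\mathbb{R}$ with $\|\mathbf{x}_i\|_2^2=d$, and let $\phi:\mathbb{R}\to\mathbb{R}$ be twice differentiable with $|\phi'|\le 1$ and $|\phi''|\le\beta_\phi$. Put $m_0=d$ and $m_l=m$ for $1\le l\le L$. For $\theta=(W^{(1)},\dots,W^{(L)},\mathbf{v})$ with $W^{(l)}\in\mathbb{R}^{m_l\times m_{l-1}}$, $\mathbf{v}\in\mathbb{R}^m$, define $\alpha^{(0)}=\mathbf{x}$, $\alpha^{(l)}=\phi\big(\tfrac{1}{\sqrt{m_{l-1}}}W^{(l)}\alpha^{(l-1)}\big)$ (coordinatewise) for $1\le l\le L$, $f(\theta;\mathbf{x})=\tfrac{1}{\sqrt m}\mathbf{v}^\top\alpha^{(L)}$, and the empirical square loss $\mathcal{L}(\theta)=\frac1n\sum_{i=1}^n (y_i-f(\theta;\mathbf{x}_i))^2$. Let $\theta_0=(W_0^{(1)},\dots,W_0^{(L)},\mathbf{v}_0)$ be random, where all entries of the $W_0^{(l)}$, $1\le l\le L$,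 are independent $\mathcal{N}(0,\sigma_0^2)$ variables with $\sigma_0=\dfrac{\sigma_1}{2\left(1+\frac{2\sqrt{\log m}}{\sqrt m}\right)}$, $\sigma_1>0$, and $\mathbf{v}_0$ is a random unit vector, $\|\mathbf{v}_0\|_2=1$ almost surely (with any distribution and any dependence on the $W_0^{(l)}$). For $\rho,\rho_1\in\mathbb{R}$ let $$B^{\mathrm{spec}}_{\rho,\rho_1}(\theta_0)=\big\{\theta : \|W^{(l)}-W^{(l)}_0\|_2\le\rho\ (1\le l\le L),\ \|\mathbf{v}-\mathbf{v}_0\|_2\le\rho_1\big\},$$ with the spectral norm for matrices and the Euclidean norm for vectors, and let $\gamma=\sigma_1+\frac{\rho}{\sqrt m}$. For real $a,b$ put $$g(a)=a^L+|\phi(0)|\sum_{i=1}^L a^{i-1},\qquad c_{a,b}=\frac2n\sum_{i=1}^n y_i^2+2(1+a)^2|g(b)|^2 .$$ Then each of the following holds with probability at least $1-\frac{2(L+1)}{m}$ over $\theta_0$: 1. $\mathcal{L}(\theta_0)\le c_{0,\sigma_1}$; 2. $\mathcal{L}(\theta)\le c_{\rho_1,\gamma}$ simultaneously for all $\theta\in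 B^{\mathrm{spec}}_{\rho,\rho_1}(\theta_0)$. -/

import Mathlib

open MeasureTheory ProbabilityTheory

noncomputable section

namespace DeepNet

/-- Parameters `θ = (W⁽¹⁾, …, W⁽ᴸ⁾, v)` of a fully connected network with `L` hidden layers and
layer widths `w 0, …, w L` (`w 0` is the input dimension). The matrix `W⁽ˡ⁺¹⁾` is `θ.W l`. -/
@[ext]
structure Params (L : ℕ) (w : ℕ → ℕ) where
  /-- the hidden layer matrices -/
  W : (l : Fin L) → Matrix (Fin (w (l + 1))) (Fin (w l)) ℝ
  /-- the weights of the linear output layer -/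
  v : EuclideanSpace ℝ (Fin (w L))

/-- Widths of a network with input dimension `d` and all hidden widths equal to `m`. -/
def constWidth (d m : ℕ) : ℕ → ℕ
  | 0 => d
  | _ + 1 => m

variable {L : ℕ} {w : ℕ → ℕ}

/-- The layerwise output `α⁽ˡ⁾(x)`, for `l ≤ L`: `α⁽⁰⁾ = x` and
`α⁽ˡ⁺¹⁾ = φ (W⁽ˡ⁺¹⁾ α⁽ˡ⁾ / √(w l))` with `φ` applied to each coordinate. -/
def layer (φ : ℝ → ℝ) (θ : Params L w) (x : EuclideanSpace ℝ (Fin (w 0))) :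
    (l : ℕ) → l ≤ L → EuclideanSpace ℝ (Fin (w l))
  | 0, _ => x
  | l + 1, h => WithLp.toLp 2 fun i =>
      φ ((1 / √(w l : ℝ)) *
        Matrix.mulVec (θ.W ⟨l, h⟩) (layer φ θ x l (Nat.le_of_succ_le h)).ofLp i)

/-- The network output `f(θ; x) = vᵀ α⁽ᴸ⁾(x) / √(w L)`. -/
def predictor (φ : ℝ → ℝ) (θ : Params L w) (x : EuclideanSpace ℝ (Fin (w 0))) : ℝ :=
  (1 / √(w L : ℝ)) * inner ℝ θ.v (layer φ θ x L le_rfl)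

/-- The square loss `ℓ(y, ŷ) = (y - ŷ)²`. -/
def squareLoss (y yhat : ℝ) : ℝ := (y - yhat) ^ 2

/-- The empirical loss `𝓛(θ) = (1/n) ∑ᵢ ℓ(yᵢ, f(θ; xᵢ))`. -/
def empiricalLoss {n : ℕ} (ℓ : ℝ → ℝ → ℝ) (φ : ℝ → ℝ)
    (x : Fin n → EuclideanSpace ℝ (Fin (w 0))) (y : Fin n → ℝ) (θ : Params L w) : ℝ :=
  (1 / (n : ℝ)) * ∑ i, ℓ (y i) (predictor φ θ (x i))

section

open scoped Matrix.Norms.L2Operator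

/-- The spectral norm (the operator norm for the Euclidean norms) of a real matrix. -/
def specNorm {p q : ℕ} (A : Matrix (Fin p) (Fin q) ℝ) : ℝ := ‖A‖

end

/-- The layerwise spectral norm ball with radius `ρ` for the hidden layer matrices and radius
`ρ₁` for the output layer, centred at `θbar`. -/
def specBall (ρ ρ₁ : ℝ) (θbar : Params L w) : Set (Params L w) :=
  {θ | (∀ l, specNorm (θ.W l - θbar.W l) ≤ ρ) ∧ ‖θ.v - θbar.v‖ ≤ ρ₁}

/-- The activation is twice differentiable with `|φ'| ≤ 1` and `|φ''| ≤ β`. -/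
structure IsSmoothActivation (φ : ℝ → ℝ) (β : ℝ) : Prop where
  differentiable : Differentiable ℝ φ
  differentiable_deriv : Differentiable ℝ (deriv φ)
  abs_deriv_le : ∀ z, |deriv φ z| ≤ 1
  abs_deriv_deriv_le : ∀ z, |deriv (deriv φ) z| ≤ β

/-- The standard deviation `σ₀ = σ₁ / (2 (1 + 2 √(log m) / √m))` of the initial weights. -/
def initStd (σ₁ : ℝ) (m : ℕ) : ℝ :=
  σ₁ / (2 * (1 + 2 * √(Real.log m) / √(m : ℝ)))

/-- Random initialization: all entries of all hidden layer matrices are independent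
`N(0, σ²)` variables, and the output vector is a random unit vector (of any distribution,
and with any dependence on the hidden weights). -/
structure IsRandomInit {Ω : Type*} [MeasurableSpace Ω] (μ : Measure Ω) (σ : ℝ)
    (θ₀ : Ω → Params L w) : Prop where
  gaussian : ∀ (l : Fin L) (i : Fin (w (l + 1))) (j : Fin (w l)),
    HasLaw (fun ω => (θ₀ ω).W l i j) (gaussianReal 0 (σ ^ 2).toNNReal) μ
  indep : iIndepFun
    (fun (k : (l : Fin L) × (Fin (w (l + 1)) × Fin (w l))) ω => (θ₀ ω).W k.1 k.2.1 k.2.2) μ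
  aemeasurable_output : AEMeasurable (fun ω => (θ₀ ω).v) μ
  norm_output : ∀ᵐ ω ∂μ, ‖(θ₀ ω).v‖ = 1

/-- `g(a) = a ^ L + |φ(0)| ∑_{i=1}^L a ^ (i-1)`. -/
def gBound (φ : ℝ → ℝ) (L : ℕ) (a : ℝ) : ℝ :=
  a ^ L + |φ 0| * ∑ i ∈ Finset.Icc 1 L, a ^ (i - 1)

/-- `c_{a,b} = (2/n) ∑ᵢ yᵢ² + 2 (1 + a)² |g(b)|²`. -/
def cBound {n : ℕ} (φ : ℝ → ℝ) (L : ℕ) (y : Fin n → ℝ) (a b : ℝ) : ℝ :=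
  (2 / (n : ℝ)) * ∑ i, y i ^ 2 + 2 * (1 + a) ^ 2 * |gBound φ L b| ^ 2

/-- The event that `P ω` holds has probability at least `p`: it contains a measurable set of
probability at least `p`. -/
def HoldsWithProb {Ω : Type*} [MeasurableSpace Ω] (μ : Measure Ω) (p : ℝ) (P : Ω → Prop) : Prop :=
  ∃ A : Set Ω, MeasurableSet A ∧ p ≤ μ.real A ∧ ∀ ω ∈ A, P ω

end DeepNet

end

open DeepNet

/-! ### Deterministic bounds given spectral norm control. -/

namespace DeepNet

/-! If every hidden matrix has spectral norm at most `γ * √m`, then `|φ z| ≤ |z| + |φ 0|` propagates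
the bound `‖α⁽ˡ⁾‖ ≤ √(m_l) g_l(γ)` through the layers (`norm_layer_le`), and `(y - f)² ≤ 2y² + 2f²`
bounds the loss (`empiricalLoss_le_cBound`). On the ball, the triangle inequality turns `σ₁ * √m`
into `γ * √m`.

What remains is a Gaussian matrix bound, `gaussianMatrix_norm_gt_le`, proved by Householder
bidiagonalization. A reflection moves the first row onto one axis; by rotation invariance the other
rows remain Gaussian, and their transpose is treated the same way. The matrix becomes bidiagonal up
to isometries, a sum of two pieces, each of norm at most the largest of the row norms met on the
way. At most `2m` rows occur, each a Gaussian vector of dimension at most `m`, whose norm exceeds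
`√m + 2√(log m)` with probability at most `1/m²`. This costs `2/m` per layer. -/

theorem IsSmoothActivation.abs_le {φ : ℝ → ℝ} {β : ℝ} (hφ : IsSmoothActivation φ β) (z : ℝ) :
    |φ z| ≤ |z| + |φ 0| := by
  have h := Convex.norm_image_sub_le_of_norm_deriv_le (f := φ) (s := Set.univ) (C := 1)
    (x := 0) (y := z) (fun x _ => hφ.differentiable x) (fun x _ => hφ.abs_deriv_le x)
    convex_univ trivial trivial
  simp only [Real.norm_eq_abs, sub_zero, one_mul] at h
  have := abs_sub_abs_le_abs_sub (φ z) (φ 0)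
  linarith

/-- Coordinatewise application of an activation that grows at most like `|z| + b`. -/
theorem norm_toLp_comp_le {k : ℕ} {φ : ℝ → ℝ} {b : ℝ} (hb : 0 ≤ b) (hφ : ∀ z, |φ z| ≤ |z| + b)
    (u : EuclideanSpace ℝ (Fin k)) :
    ‖(WithLp.toLp 2 fun i => φ (u i) : EuclideanSpace ℝ (Fin k))‖ ≤ ‖u‖ + √k * b := by
  have h1 : ‖(WithLp.toLp 2 fun i => φ (u i) : EuclideanSpace ℝ (Fin k))‖ ≤
      ‖(WithLp.toLp 2 (fun i => |u i|) : EuclideanSpace ℝ (Fin k)) +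
        WithLp.toLp 2 (fun _ => b)‖ := by
    rw [EuclideanSpace.norm_eq, EuclideanSpace.norm_eq]
    refine Real.sqrt_le_sqrt (Finset.sum_le_sum fun i _ => ?_)
    have h2 : 0 ≤ |u i| + b := by positivity
    simpa [abs_of_nonneg h2] using pow_le_pow_left₀ (abs_nonneg _) (hφ (u i)) 2
  refine h1.trans ((norm_add_le _ _).trans (add_le_add (le_of_eq ?_) (le_of_eq ?_)))
  · rw [EuclideanSpace.norm_eq, EuclideanSpace.norm_eq]; simp
  · rw [EuclideanSpace.norm_eq]; simp [Real.sqrt_sq_eq_abs, abs_of_nonneg hb]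

theorem norm_mulVec_le_specNorm {p q : ℕ} (A : Matrix (Fin p) (Fin q) ℝ)
    (u : EuclideanSpace ℝ (Fin q)) :
    ‖(WithLp.toLp 2 (Matrix.mulVec A u.ofLp) : EuclideanSpace ℝ (Fin p))‖ ≤
      specNorm A * ‖u‖ :=
  Matrix.l2_opNorm_mulVec A u

open scoped Matrix.Norms.L2Operator in
theorem specNorm_nonneg {p q : ℕ} (A : Matrix (Fin p) (Fin q) ℝ) : 0 ≤ specNorm A :=
  norm_nonneg A

open scoped Matrix.Norms.L2Operator in
theorem specNorm_le_add_sub {p q : ℕ} (A B : Matrix (Fin p) (Fin q) ℝ) :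
    specNorm A ≤ specNorm B + specNorm (A - B) :=
  norm_le_insert' A B

/-- This recursion mirrors one layer: a factor `a` from the matrix, an additive `|φ 0|` from the
activation. -/
theorem gBound_succ (φ : ℝ → ℝ) (l : ℕ) (a : ℝ) :
    gBound φ (l + 1) a = a * gBound φ l a + |φ 0| := by
  have h : ∀ k, ∑ i ∈ Finset.Icc 1 k, a ^ (i - 1) = ∑ i ∈ Finset.range k, a ^ i := fun k => by
    rw [← Finset.Ico_add_one_right_eq_Icc, Finset.sum_Ico_eq_sum_range]
    simp
  simp only [gBound, h]
  rw [Finset.sum_range_succ', pow_succ', mul_add, mul_add, mul_left_comm a, Finset.mul_sum _ _ a]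
  simp only [pow_succ']
  ring

variable {L : ℕ} {d m : ℕ}

/-- Layerwise norm bound `‖α⁽ˡ⁾‖ ≤ √(m_l) g_l(γ)`. -/
theorem norm_layer_le (hd : 0 < d) (hm : 0 < m) {φ : ℝ → ℝ} {β : ℝ} (hφ : IsSmoothActivation φ β)
    {γ : ℝ} (hγ : 0 ≤ γ) (θ : Params L (constWidth d m))
    (hθ : ∀ l, specNorm (θ.W l) ≤ γ * √m)
    (x : EuclideanSpace ℝ (Fin (constWidth d m 0))) (hx : ‖x‖ ^ 2 = (d : ℝ)) (l : ℕ) (hl : l ≤ L) :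
    ‖layer φ θ x l hl‖ ≤ √(constWidth d m l) * gBound φ l γ := by
  induction l with
  | zero =>
    have : ‖x‖ = √d := by rw [← hx, Real.sqrt_sq (norm_nonneg _)]
    simp [layer, gBound, constWidth]
    exact this.le
  | succ l ih =>
    have hw : 0 < √(constWidth d m l : ℝ) := by
      cases l <;> simpa [constWidth]
    set u : EuclideanSpace ℝ (Fin (constWidth d m (l + 1))) :=
      (1 / √(constWidth d m l : ℝ)) • WithLp.toLp 2
        (Matrix.mulVec (θ.W ⟨l, hl⟩) (layer φ θ x l (Nat.le_of_succ_le hl)).ofLp) with hu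
    have h1 := norm_toLp_comp_le (abs_nonneg (φ 0)) hφ.abs_le u
    have h2 : ‖u‖ ≤ √m * (γ * gBound φ l γ) := by
      rw [hu, norm_smul, Real.norm_of_nonneg (by positivity), one_div, inv_mul_le_iff₀ hw]
      calc _ ≤ specNorm (θ.W ⟨l, hl⟩) * ‖layer φ θ x l (Nat.le_of_succ_le hl)‖ :=
            norm_mulVec_le_specNorm _ _
        _ ≤ (γ * √m) * (√(constWidth d m l) * gBound φ l γ) :=
            mul_le_mul (hθ _) (ih _) (norm_nonneg _) (by positivity)
        _ = _ := by ring
    rw [gBound_succ, mul_add]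
    exact h1.trans (add_le_add_left h2 _)

theorem abs_predictor_le (hd : 0 < d) (hm : 0 < m) {φ : ℝ → ℝ} {β : ℝ}
    (hφ : IsSmoothActivation φ β)
    {γ a : ℝ} (hγ : 0 ≤ γ) (θ : Params L (constWidth d m))
    (hθ : ∀ l, specNorm (θ.W l) ≤ γ * √m) (hv : ‖θ.v‖ ≤ a)
    (x : EuclideanSpace ℝ (Fin (constWidth d m 0))) (hx : ‖x‖ ^ 2 = (d : ℝ)) :
    |predictor φ θ x| ≤ a * gBound φ L γ := by
  have hw : 0 < √(constWidth d m L : ℝ) := by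
    cases L <;> simpa [constWidth]
  rw [predictor, abs_mul, abs_of_nonneg (by positivity), one_div, inv_mul_le_iff₀ hw]
  calc _ ≤ ‖θ.v‖ * ‖layer φ θ x L le_rfl‖ := abs_real_inner_le_norm _ _
    _ ≤ a * (√(constWidth d m L) * gBound φ L γ) :=
      mul_le_mul hv (norm_layer_le hd hm hφ hγ θ hθ x hx L le_rfl) (norm_nonneg _)
        ((norm_nonneg _).trans hv)
    _ = _ := by ring

theorem empiricalLoss_le_cBound {n : ℕ} (hn : 0 < n) (hd : 0 < d) (hm : 0 < m)
    {φ : ℝ → ℝ} {β : ℝ} (hφ : IsSmoothActivation φ β)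
    {γ a : ℝ} (hγ : 0 ≤ γ) (θ : Params L (constWidth d m))
    (hθ : ∀ l, specNorm (θ.W l) ≤ γ * √m) (hv : ‖θ.v‖ ≤ 1 + a)
    (x : Fin n → EuclideanSpace ℝ (Fin (constWidth d m 0))) (hx : ∀ i, ‖x i‖ ^ 2 = (d : ℝ))
    (y : Fin n → ℝ) :
    empiricalLoss squareLoss φ x y θ ≤ cBound φ L y a γ := by
  have h1 : ∀ i, squareLoss (y i) (predictor φ θ (x i)) ≤
      2 * y i ^ 2 + 2 * (1 + a) ^ 2 * |gBound φ L γ| ^ 2 := fun i => by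
    have h := abs_predictor_le hd hm hφ hγ θ hθ hv (x i) (hx i)
    have h2 : predictor φ θ (x i) ^ 2 ≤ ((1 + a) * gBound φ L γ) ^ 2 :=
      sq_le_sq.2 (h.trans (le_abs_self _))
    rw [sq_abs, squareLoss]
    -- Uses `(y - f)² + (y + f)² = 2y² + 2f²`.
    nlinarith [sq_nonneg (y i + predictor φ θ (x i))]
  have hn' : (0 : ℝ) < n := by exact_mod_cast hn
  unfold empiricalLoss cBound
  rw [one_div, inv_mul_le_iff₀ hn']
  calc _ ≤ ∑ i : Fin n, (2 * y i ^ 2 + 2 * (1 + a) ^ 2 * |gBound φ L γ| ^ 2) :=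
        Finset.sum_le_sum fun i _ => h1 i
    _ = _ := by
      rw [Finset.sum_add_distrib, ← Finset.mul_sum]
      simp
      field_simp

end DeepNet

/-! ### Tail of the norm of a Gaussian vector. -/

section

open scoped Matrix.Norms.L2Operator Pointwise ENNReal

theorem integral_exp_mul_sq_gaussianReal {b : ℝ} (hb : 0 < b) :
    ∫ x, Real.exp ((1 - b) / 2 * x ^ 2) ∂gaussianReal 0 1 = 1 / √b := by
  rw [integral_gaussianReal_eq_integral_smul one_ne_zero]
  have h : ∀ x : ℝ, gaussianPDFReal 0 1 x • Real.exp ((1 - b) / 2 * x ^ 2) =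
      (√(2 * Real.pi))⁻¹ * Real.exp (-(b / 2) * x ^ 2) := fun x => by
    simp only [gaussianPDFReal, smul_eq_mul, NNReal.coe_one, mul_one, mul_assoc, sub_zero]
    rw [← Real.exp_add]
    congr 2
    ring
  simp_rw [h]
  rw [integral_const_mul, integral_gaussian, ← Real.sqrt_inv, ← Real.sqrt_mul (by positivity),
    one_div, ← Real.sqrt_inv]
  congr 1
  field_simp

/-- A non-integrable function has Bochner integral `0`, but the value computed above is positive. -/
theorem integrable_exp_mul_sq_gaussianReal {b : ℝ} (hb : 0 < b) :
    Integrable (fun x => Real.exp ((1 - b) / 2 * x ^ 2)) (gaussianReal 0 1) := by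
  by_contra h
  have h1 := integral_exp_mul_sq_gaussianReal hb
  rw [integral_undef h] at h1
  have : 0 < 1 / √b := by positivity
  linarith

/-- Chernoff bound for the norm of a standard Gaussian vector in dimension at most `m`. -/
theorem pi_gaussianReal_norm_gt_le {k m : ℕ} (hkm : k ≤ m) (hm : 0 < m) {t : ℝ} (ht : 0 ≤ t) :
    (Measure.pi fun _ : Fin k => gaussianReal 0 1).real
      {r | √m + t < ‖(WithLp.toLp 2 r : EuclideanSpace ℝ (Fin k))‖} ≤ Real.exp (-t ^ 2 / 2) := by
  set μ := Measure.pi fun _ : Fin k => gaussianReal 0 1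
  have hm' : (0 : ℝ) < √m := by simpa using hm
  set c : ℝ := √m + t with hc
  have hc0 : 0 < c := by positivity
  -- `b = m / c²` is the optimal Chernoff tilt in dimension `m`.
  set b : ℝ := (√m / c) ^ 2 with hb
  have hb0 : 0 < b := by positivity
  have hb1 : b ≤ 1 := by
    rw [hb, sq_le_one_iff₀ (by positivity), div_le_one hc0]; linarith
  have hsq : (√m) ^ 2 = (m : ℝ) := Real.sq_sqrt (by positivity)
  have hexp : ∀ r : Fin k → ℝ, Real.exp ((1 - b) / 2 *
      ‖(WithLp.toLp 2 r : EuclideanSpace ℝ (Fin k))‖ ^ 2) =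
      ∏ i, Real.exp ((1 - b) / 2 * r i ^ 2) := fun r => by
    rw [EuclideanSpace.real_norm_sq_eq, Finset.mul_sum, Real.exp_sum]
  have hint : ∫ r, Real.exp ((1 - b) / 2 *
      ‖(WithLp.toLp 2 r : EuclideanSpace ℝ (Fin k))‖ ^ 2) ∂μ = (c / √m) ^ k := by
    simp_rw [hexp]
    rw [integral_fintype_prod_eq_prod (fun _ x => Real.exp ((1 - b) / 2 * x ^ 2))]
    simp_rw [integral_exp_mul_sq_gaussianReal hb0]
    rw [hb, Real.sqrt_sq (by positivity), one_div_div]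
    simp [div_pow]
  have hi : Integrable (fun r => Real.exp ((1 - b) / 2 *
      ‖(WithLp.toLp 2 r : EuclideanSpace ℝ (Fin k))‖ ^ 2)) μ := by
    simp_rw [hexp]
    exact Integrable.fintype_prod fun _ => integrable_exp_mul_sq_gaussianReal hb0
  have hmarkov := mul_meas_ge_le_integral_of_nonneg (μ := μ)
    (Filter.Eventually.of_forall fun r => (Real.exp_pos _).le) hi (Real.exp ((1 - b) / 2 * c ^ 2))
  rw [hint] at hmarkov
  have hmono : μ.real {r | c < ‖(WithLp.toLp 2 r : EuclideanSpace ℝ (Fin k))‖} ≤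
      μ.real {r | Real.exp ((1 - b) / 2 * c ^ 2) ≤ Real.exp ((1 - b) / 2 *
      ‖(WithLp.toLp 2 r : EuclideanSpace ℝ (Fin k))‖ ^ 2)} := by
    refine measureReal_mono fun r hr => ?_
    simp only [Set.mem_ofPred_eq] at hr ⊢
    have : 0 ≤ (1 - b) / 2 := by linarith
    gcongr
  -- Since `c / √m ≥ 1`, the dimension `k` may be raised to `m`; then `1 + s ≤ exp s` with `s = t /
  -- √m`.
  have hck : (c / √m) ^ k ≤ Real.exp (t * √m) := by
    have h1 : (1 : ℝ) ≤ c / √m := by rw [one_le_div hm']; linarith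
    have h2 : c / √m ≤ Real.exp (t / √m) := by
      have := Real.add_one_le_exp (t / √m)
      have h3 : c / √m = t / √m + 1 := by rw [hc]; field_simp; ring
      linarith
    calc (c / √m) ^ k ≤ (c / √m) ^ m := pow_le_pow_right₀ h1 hkm
      _ ≤ Real.exp (t / √m) ^ m := pow_le_pow_left₀ (by positivity) h2 m
      _ = Real.exp (t * √m) := by
        rw [← Real.exp_nat_mul]; congr 1
        rw [mul_div_assoc', div_eq_iff hm'.ne']
        linear_combination (-t) * hsq
  have hexpo : (1 - b) / 2 * c ^ 2 = t * √m + t ^ 2 / 2 := by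
    have : b * c ^ 2 = m := by
      rw [hb, div_pow, div_mul_cancel₀ _ (by positivity), hsq]
    have h2 : c ^ 2 = m + 2 * √m * t + t ^ 2 := by
      rw [hc]; linear_combination hsq
    linear_combination (-1 / 2) * this + (1 / 2) * h2
  rw [hexpo] at hmarkov hmono
  refine hmono.trans ?_
  have h4 : Real.exp (-t ^ 2 / 2) = Real.exp (t * √m) / Real.exp (t * √m + t ^ 2 / 2) := by
    rw [← Real.exp_sub]; congr 1; ring
  rw [h4, le_div_iff₀ (Real.exp_pos _), mul_comm]
  exact hmarkov.trans hck

/-! ### Invariance of Gaussian matrices under transposition and rotation. -/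

namespace DeepNet

/-- The law of a `p × q` matrix with independent standard Gaussian entries. -/
noncomputable abbrev gaussianMatrix (p q : ℕ) : Measure (Fin p → Fin q → ℝ) :=
  Measure.pi fun _ => Measure.pi fun _ => gaussianReal 0 1

theorem pi_prod_eq_map_uncurry (p q : ℕ) :
    (Measure.pi fun _ : Fin p × Fin q => gaussianReal 0 1) =
      (gaussianMatrix p q).map Function.uncurry := by
  refine Measure.pi_eq fun s hs => ?_
  rw [Measure.map_apply measurable_uncurry (MeasurableSet.univ_pi hs)]
  have : Function.uncurry ⁻¹' (Set.univ.pi s) =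
      Set.univ.pi fun i : Fin p => Set.univ.pi fun j : Fin q => s (i, j) := by
    ext G; simp [Set.mem_pi]
  rw [this, Measure.pi_pi, Fintype.prod_prod_type]
  simp_rw [Measure.pi_pi]

theorem measurePreserving_curry (p q : ℕ) :
    MeasurePreserving Function.curry (Measure.pi fun _ : Fin p × Fin q => gaussianReal 0 1)
      (gaussianMatrix p q) := by
  refine ⟨measurable_curry, ?_⟩
  rw [pi_prod_eq_map_uncurry, Measure.map_map measurable_curry measurable_uncurry]
  exact Measure.map_id

theorem measurePreserving_uncurry (p q : ℕ) :
    MeasurePreserving Function.uncurry (gaussianMatrix p q)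
      (Measure.pi fun _ : Fin p × Fin q => gaussianReal 0 1) :=
  ⟨measurable_uncurry, (pi_prod_eq_map_uncurry p q).symm⟩

theorem measurePreserving_swap (p q : ℕ) :
    MeasurePreserving (fun (G : Fin p → Fin q → ℝ) j i => G i j) (gaussianMatrix p q)
      (gaussianMatrix q p) := by
  have h := (measurePreserving_piCongrLeft (fun _ : Fin q × Fin p => gaussianReal 0 1)
    (Equiv.prodComm (Fin p) (Fin q)))
  exact (measurePreserving_curry q p).comp (h.comp (measurePreserving_uncurry p q))

/-- Action of an isometry of Euclidean space on plain vectors. -/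
noncomputable def rotate {q : ℕ} (T : EuclideanSpace ℝ (Fin q) ≃ₗᵢ[ℝ] EuclideanSpace ℝ (Fin q))
    (r : Fin q → ℝ) : Fin q → ℝ := (T (WithLp.toLp 2 r)).ofLp

theorem measurePreserving_rotate {q : ℕ}
    (T : EuclideanSpace ℝ (Fin q) ≃ₗᵢ[ℝ] EuclideanSpace ℝ (Fin q)) :
    MeasurePreserving (rotate T) (Measure.pi fun _ => gaussianReal 0 1)
      (Measure.pi fun _ => gaussianReal 0 1) := by
  have h1 : MeasurePreserving (WithLp.toLp 2 : (Fin q → ℝ) → EuclideanSpace ℝ (Fin q))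
      (Measure.pi fun _ => gaussianReal 0 1) (stdGaussian (EuclideanSpace ℝ (Fin q))) :=
    ⟨by fun_prop, map_pi_eq_stdGaussian⟩
  have h2 : MeasurePreserving T (stdGaussian (EuclideanSpace ℝ (Fin q)))
      (stdGaussian (EuclideanSpace ℝ (Fin q))) := ⟨by fun_prop, stdGaussian_map T⟩
  have h3 : MeasurePreserving (WithLp.ofLp : EuclideanSpace ℝ (Fin q) → (Fin q → ℝ))
      (stdGaussian (EuclideanSpace ℝ (Fin q))) (Measure.pi fun _ => gaussianReal 0 1) := by
    refine ⟨by fun_prop, ?_⟩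
    rw [← map_pi_eq_stdGaussian, Measure.map_map (by fun_prop) (by fun_prop)]
    exact Measure.map_id
  exact h3.comp (h2.comp h1)

theorem norm_toLp_rotate {q : ℕ}
    (T : EuclideanSpace ℝ (Fin q) ≃ₗᵢ[ℝ] EuclideanSpace ℝ (Fin q)) (r : Fin q → ℝ) :
    ‖(WithLp.toLp 2 (rotate T r) : EuclideanSpace ℝ (Fin q))‖ =
      ‖(WithLp.toLp 2 r : EuclideanSpace ℝ (Fin q))‖ := T.norm_map _

/-- A rotation taking a given vector to a multiple of the first basis vector. -/
theorem exists_rotate_eq_zero {q : ℕ} (r : Fin q → ℝ) :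
    ∃ T : EuclideanSpace ℝ (Fin q) ≃ₗᵢ[ℝ] EuclideanSpace ℝ (Fin q),
      ∀ j : Fin q, (j : ℕ) ≠ 0 → rotate T r j = 0 := by
  cases q with
  | zero => exact ⟨LinearIsometryEquiv.refl ℝ _, fun j => j.elim0⟩
  | succ q =>
    set v : EuclideanSpace ℝ (Fin (q + 1)) := WithLp.toLp 2 r
    set w : EuclideanSpace ℝ (Fin (q + 1)) := EuclideanSpace.single 0 ‖v‖
    have h : ‖v‖ = ‖w‖ := by simp [w]
    -- Householder reflection: it exchanges `v` and `w` because their norms agree.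
    refine ⟨(ℝ ∙ (v - w))ᗮ.reflection, fun j hj => ?_⟩
    have h1 := Submodule.reflection_sub h
    change ((ℝ ∙ (v - w))ᗮ.reflection v).ofLp j = 0
    rw [h1]
    have : j ≠ 0 := fun h0 => hj (by simp [h0])
    simp [w, this]

/-! ### The two-piece splitting and its induction. -/

theorem l2_opNorm_transpose {p q : ℕ} (A : Matrix (Fin p) (Fin q) ℝ) : ‖A.transpose‖ = ‖A‖ := by
  rw [← Matrix.l2_opNorm_conjTranspose A, Matrix.conjTranspose_eq_transpose_of_trivial]

/-- Left multiplication by row vectors suits the later steps, which rotate rows and prepend a row.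
-/
theorem l2_opNorm_le_iff_vecMul {p q : ℕ} (A : Matrix (Fin p) (Fin q) ℝ) {a : ℝ} (ha : 0 ≤ a) :
    ‖A‖ ≤ a ↔ ∀ y : Fin p → ℝ,
      ‖(WithLp.toLp 2 (Matrix.vecMul y A) : EuclideanSpace ℝ (Fin q))‖ ≤
        a * ‖(WithLp.toLp 2 y : EuclideanSpace ℝ (Fin p))‖ := by
  rw [← l2_opNorm_transpose A]
  constructor
  · intro h y
    have h1 := Matrix.l2_opNorm_mulVec A.transpose (WithLp.toLp 2 y)
    rw [Matrix.mulVec_transpose] at h1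
    exact h1.trans (mul_le_mul_of_nonneg_right h (norm_nonneg _))
  · intro h
    rw [Matrix.l2_opNorm_def]
    refine ContinuousLinearMap.opNorm_le_bound _ ha fun y => ?_
    have h1 := h y.ofLp
    rw [← Matrix.mulVec_transpose] at h1
    exact h1

/-- Matrices `A + B` where `A` and `B` have spectral norm at most `c` and the first row of `B`
vanishes. -/
def splitSet (p q : ℕ) (c : ℝ) : Set (Fin p → Fin q → ℝ) :=
  {G | ∃ A B : Matrix (Fin p) (Fin q) ℝ, ‖A‖ ≤ c ∧ ‖B‖ ≤ c ∧
    (∀ i : Fin p, (i : ℕ) = 0 → ∀ j, B i j = 0) ∧ Matrix.of G = A + B}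

theorem norm_le_of_mem_splitSet {p q : ℕ} {c : ℝ} {G : Fin p → Fin q → ℝ}
    (hG : G ∈ splitSet p q c) : ‖Matrix.of G‖ ≤ 2 * c := by
  obtain ⟨A, B, hA, hB, -, h⟩ := hG
  rw [h]
  linarith [norm_add_le A B]

/-- Closedness supplies measurability, which the existential definition does not show. The set is
the sum of two compact sets. -/
theorem isClosed_splitSet (p q : ℕ) (c : ℝ) : IsClosed (splitSet p q c) := by
  have : ProperSpace (Matrix (Fin p) (Fin q) ℝ) := FiniteDimensional.proper ℝ _
  have h1 : IsCompact (Metric.closedBall (0 : Matrix (Fin p) (Fin q) ℝ) c) :=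
    isCompact_closedBall _ _
  have h2 : IsClosed {B : Matrix (Fin p) (Fin q) ℝ |
      ∀ i : Fin p, (i : ℕ) = 0 → ∀ j, B i j = 0} := by
    simp only [Set.ofPred_forall]
    refine isClosed_iInter fun i => isClosed_iInter fun _ => isClosed_iInter fun j => ?_
    exact isClosed_eq (by fun_prop) continuous_const
  have h3 := (h1.add (h1.inter_right h2)).isClosed
  have h4 : splitSet p q c = Matrix.of ⁻¹' (Metric.closedBall (0 : Matrix (Fin p) (Fin q) ℝ) c +
      (Metric.closedBall 0 c ∩ {B : Matrix (Fin p) (Fin q) ℝ |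
        ∀ i : Fin p, (i : ℕ) = 0 → ∀ j, B i j = 0})) := by
    ext G
    simp only [splitSet, Set.mem_ofPred_eq, Set.mem_preimage, Set.mem_add, Set.mem_inter_iff,
      mem_closedBall_zero_iff]
    constructor
    · rintro ⟨A, B, hA, hB, h, e⟩; exact ⟨A, hA, B, ⟨hB, h⟩, e.symm⟩
    · rintro ⟨A, hA, B, ⟨hB, h⟩, e⟩; exact ⟨A, B, hA, hB, h, e.symm⟩
  rw [h4]
  exact h3.preimage continuous_id

theorem measurableSet_splitSet (p q : ℕ) (c : ℝ) : MeasurableSet (splitSet p q c) :=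
  (isClosed_splitSet p q c).measurableSet

theorem vecMul_rotate {p q : ℕ} (T : EuclideanSpace ℝ (Fin q) ≃ₗᵢ[ℝ] EuclideanSpace ℝ (Fin q))
    (A : Matrix (Fin p) (Fin q) ℝ) (y : Fin p → ℝ) :
    Matrix.vecMul y (Matrix.of fun i => rotate T (A i)) = rotate T (Matrix.vecMul y A) := by
  simp only [Matrix.vecMul_eq_sum, rotate]
  have : (WithLp.toLp 2 (∑ i, y i • A i) : EuclideanSpace ℝ (Fin q)) =
      ∑ i, y i • WithLp.toLp 2 (A i) := by simp
  rw [this, map_sum]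
  simp only [map_smul, WithLp.ofLp_sum, WithLp.ofLp_smul]
  rfl

theorem rotate_mem_splitSet {p q : ℕ} {c : ℝ} (hc : 0 ≤ c)
    (T : EuclideanSpace ℝ (Fin q) ≃ₗᵢ[ℝ] EuclideanSpace ℝ (Fin q)) {G : Fin p → Fin q → ℝ}
    (hG : G ∈ splitSet p q c) : (fun i => rotate T (G i)) ∈ splitSet p q c := by
  obtain ⟨A, B, hA, hB, hB0, h⟩ := hG
  have key : ∀ C : Matrix (Fin p) (Fin q) ℝ, ‖C‖ ≤ c →
      ‖Matrix.of fun i => rotate T (C i)‖ ≤ c := fun C hC => by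
    rw [l2_opNorm_le_iff_vecMul _ hc] at hC ⊢
    intro y
    rw [vecMul_rotate, norm_toLp_rotate]
    exact hC y
  refine ⟨_, _, key A hA, key B hB, fun i hi j => ?_, ?_⟩
  · have : B i = 0 := funext fun j => hB0 i hi j
    simp [rotate, this]
  · ext i j
    have : G i = A i + B i := congrFun h i
    simp [rotate, this]

/-- Inductive step of the bidiagonalization. Transposing exchanges the roles of the pieces: `Bᵀ` has
zero first column, so `r`, supported there, can be placed on top of it without raising the norm
above `c`, while `Aᵀ` receives a zero row. -/
theorem cons_mem_splitSet {p q : ℕ} {c : ℝ} (hc : 0 ≤ c) {r : Fin q → ℝ}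
    (hr : ‖(WithLp.toLp 2 r : EuclideanSpace ℝ (Fin q))‖ ≤ c)
    (hr0 : ∀ j : Fin q, (j : ℕ) ≠ 0 → r j = 0) {G : Fin p → Fin q → ℝ}
    (hG : (fun j i => G i j) ∈ splitSet q p c) :
    (Fin.cons r G : Fin (p + 1) → Fin q → ℝ) ∈ splitSet (p + 1) q c := by
  obtain ⟨A, B, hA, hB, hB0, h⟩ := hG
  rw [← l2_opNorm_transpose, l2_opNorm_le_iff_vecMul _ hc] at hA hB
  have hns : ∀ y : Fin (p + 1) → ℝ, ‖(WithLp.toLp 2 y : EuclideanSpace ℝ (Fin (p + 1)))‖ ^ 2 =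
      y 0 ^ 2 + ‖(WithLp.toLp 2 (Fin.tail y) : EuclideanSpace ℝ (Fin p))‖ ^ 2 := fun y => by
    rw [EuclideanSpace.real_norm_sq_eq, EuclideanSpace.real_norm_sq_eq, Fin.sum_univ_succ]
    rfl
  have hvm : ∀ (y : Fin (p + 1) → ℝ) (s : Fin q → ℝ) (C : Matrix (Fin p) (Fin q) ℝ),
      Matrix.vecMul y (Matrix.of (Fin.cons s C : Fin (p + 1) → Fin q → ℝ)) =
        y 0 • s + Matrix.vecMul (Fin.tail y) C := fun y s C => by
    simp only [Matrix.vecMul_eq_sum]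
    rw [Fin.sum_univ_succ]
    rfl
  refine ⟨Matrix.of (Fin.cons r B.transpose : Fin (p + 1) → Fin q → ℝ),
    Matrix.of (Fin.cons 0 A.transpose : Fin (p + 1) → Fin q → ℝ), ?_, ?_, ?_, ?_⟩
  · rw [l2_opNorm_le_iff_vecMul _ hc]
    intro y
    rw [hvm]
    refine le_of_sq_le_sq ?_ (by positivity)
    rw [mul_pow, hns]
    have hz : ∀ j : Fin q, (j : ℕ) = 0 → Matrix.vecMul (Fin.tail y) B.transpose j = 0 :=
      fun j hj => by
        simp [Matrix.vecMul, dotProduct, hB0 j hj]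
    -- Pythagoras: the two summands have disjoint supports.
    have h1 : ‖(WithLp.toLp 2 (y 0 • r + Matrix.vecMul (Fin.tail y) B.transpose) :
        EuclideanSpace ℝ (Fin q))‖ ^ 2 = y 0 ^ 2 * ‖(WithLp.toLp 2 r : EuclideanSpace ℝ (Fin q))‖ ^ 2
        + ‖(WithLp.toLp 2 (Matrix.vecMul (Fin.tail y) B.transpose) :
          EuclideanSpace ℝ (Fin q))‖ ^ 2 := by
      simp only [EuclideanSpace.real_norm_sq_eq]
      rw [Finset.mul_sum, ← Finset.sum_add_distrib]
      refine Finset.sum_congr rfl fun j _ => ?_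
      by_cases hj : (j : ℕ) = 0
      · simp [hz j hj, mul_pow]
      · simp [hr0 j hj]
    rw [h1, mul_add]
    have h2 := pow_le_pow_left₀ (norm_nonneg _) (hB (Fin.tail y)) 2
    have h3 := pow_le_pow_left₀ (norm_nonneg _) hr 2
    rw [mul_pow] at h2
    nlinarith [sq_nonneg (y 0)]
  · rw [l2_opNorm_le_iff_vecMul _ hc]
    intro y
    rw [hvm, smul_zero, zero_add]
    refine (hA _).trans (mul_le_mul_of_nonneg_left ?_ hc)
    refine le_of_sq_le_sq ?_ (norm_nonneg _)
    rw [hns]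
    nlinarith [sq_nonneg (y 0)]
  · intro i hi j
    have : i = 0 := Fin.ext hi
    subst this
    rfl
  · ext i j
    refine Fin.cases ?_ (fun i => ?_) i
    · change r j = r j + 0
      rw [add_zero]
    · have : G i j = A j i + B j i := congrFun (congrFun h j) i
      change G i j = B j i + A j i
      rw [this, add_comm]

/-- Fubini over the first row `r`: a long row is charged to the first term; for a short one, the
rotation aligning `r` preserves the law of the remaining rows. -/
theorem gaussianMatrix_splitSet_compl_succ_le (p q : ℕ) {c : ℝ} (hc : 0 ≤ c) :
    gaussianMatrix (p + 1) q (splitSet (p + 1) q c)ᶜ ≤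
      (Measure.pi fun _ : Fin q => gaussianReal 0 1)
        {r | c < ‖(WithLp.toLp 2 r : EuclideanSpace ℝ (Fin q))‖} +
      gaussianMatrix q p (splitSet q p c)ᶜ := by
  set γ := Measure.pi fun _ : Fin q => gaussianReal 0 1
  set N : Set (Fin q → ℝ) := {r | c < ‖(WithLp.toLp 2 r : EuclideanSpace ℝ (Fin q))‖} with hN
  have hNm : MeasurableSet N := measurableSet_lt measurable_const (by fun_prop)
  have hcm := (measurableSet_splitSet (p + 1) q c).compl
  have hmp := (measurePreserving_piFinSuccAbove (fun _ : Fin (p + 1) => γ) 0).symm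
  have h1 := hmp.measure_preimage hcm.nullMeasurableSet
  rw [← h1, Measure.prod_apply (hmp.measurable hcm)]
  have hpt : ∀ r, gaussianMatrix p q (Prod.mk r ⁻¹'
      ((MeasurableEquiv.piFinSuccAbove (fun _ : Fin (p + 1) => (Fin q → ℝ)) 0).symm ⁻¹'
        (splitSet (p + 1) q c)ᶜ)) ≤ N.indicator 1 r + gaussianMatrix q p (splitSet q p c)ᶜ := by
    intro r
    by_cases hr : r ∈ N
    · rw [Set.indicator_of_mem hr]
      exact prob_le_one.trans le_self_add
    rw [Set.indicator_of_notMem hr, zero_add]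
    have hr' : ‖(WithLp.toLp 2 r : EuclideanSpace ℝ (Fin q))‖ ≤ c := not_lt.1 hr
    obtain ⟨T, hT⟩ := exists_rotate_eq_zero r
    have hrot : MeasurePreserving (fun (G : Fin p → Fin q → ℝ) i => rotate T (G i))
        (gaussianMatrix p q) (gaussianMatrix p q) :=
      measurePreserving_pi _ _ fun _ => measurePreserving_rotate T
    have hcomp := (measurePreserving_swap p q).comp hrot
    rw [← hcomp.measure_preimage (measurableSet_splitSet q p c).compl.nullMeasurableSet]
    refine measure_mono fun G hG hG' => hG ?_
    -- Membership is obtained for the rotated matrix, then `T.symm` undoes the rotation.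
    have h2 := rotate_mem_splitSet hc T.symm (cons_mem_splitSet hc
      ((norm_toLp_rotate T r).trans_le hr') hT
      (G := fun i => rotate T (G i)) hG')
    have h3 : (fun i => rotate T.symm
        ((Fin.cons (rotate T r) fun i => rotate T (G i) : Fin (p + 1) → Fin q → ℝ) i)) =
        (MeasurableEquiv.piFinSuccAbove (fun _ : Fin (p + 1) => (Fin q → ℝ)) 0).symm (r, G) := by
      have hinv : ∀ s, rotate T.symm (rotate T s) = s := fun s => by simp [rotate]
      funext i
      refine Fin.cases ?_ (fun i => ?_) i
      · exact hinv r
      · exact hinv (G i)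
    rw [h3] at h2
    exact h2
  refine (lintegral_mono hpt).trans ?_
  rw [lintegral_add_right _ measurable_const, lintegral_indicator_one hNm]
  simp

theorem splitSet_zero_left (q : ℕ) {c : ℝ} (hc : 0 ≤ c) : splitSet 0 q c = Set.univ := by
  rw [Set.eq_univ_iff_forall]
  refine fun G => ⟨0, 0, by simpa, by simpa, fun i => i.elim0, ?_⟩
  ext i
  exact i.elim0

/-- Induction on `p + q`, since each step removes one row and then exchanges the dimensions. -/
theorem gaussianMatrix_splitSet_compl_le {c : ℝ} (hc : 0 ≤ c) {m : ℕ} {ε : ℝ≥0∞}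
    (hε : ∀ k ≤ m, (Measure.pi fun _ : Fin k => gaussianReal 0 1)
        {r | c < ‖(WithLp.toLp 2 r : EuclideanSpace ℝ (Fin k))‖} ≤ ε) (n : ℕ) :
    ∀ p q : ℕ, p + q = n → p ≤ m → q ≤ m →
      gaussianMatrix p q (splitSet p q c)ᶜ ≤ n * ε := by
  induction n with
  | zero =>
    intro p q hpq _ _
    obtain rfl : p = 0 := by omega
    simp [splitSet_zero_left q hc]
  | succ n ih =>
    intro p q hpq hp hq
    rcases p with _ | p
    · simp [splitSet_zero_left q hc]
    · refine (gaussianMatrix_splitSet_compl_succ_le p q hc).trans ?_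
      rw [Nat.cast_succ, add_mul, one_mul, add_comm]
      exact add_le_add (ih q p (by omega) hq (by omega)) (hε q hq)

/-- A `p × q` standard Gaussian matrix with `p, q ≤ m` has spectral norm at most
`2 (√m + 2 √(log m))` with probability at least `1 - 2 / m`. -/
theorem gaussianMatrix_norm_gt_le {m p q : ℕ} (hm : 0 < m) (hp : p ≤ m) (hq : q ≤ m) :
    (gaussianMatrix p q) {G | 2 * (√m + 2 * √(Real.log m)) < ‖Matrix.of G‖} ≤
      ENNReal.ofReal (2 / m) := by
  have hm1 : (1 : ℝ) ≤ m := by exact_mod_cast hm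
  have hm0 : (0 : ℝ) < m := by linarith
  have hexp : Real.exp (-(2 * √(Real.log m)) ^ 2 / 2) = 1 / (m : ℝ) ^ 2 := by
    have : -(2 * √(Real.log m)) ^ 2 / 2 = -(2 * Real.log m) := by
      rw [mul_pow, Real.sq_sqrt (Real.log_nonneg hm1)]; ring
    rw [this, Real.exp_neg, two_mul, Real.exp_add, Real.exp_log hm0, ← sq, one_div]
  have hε : ∀ k ≤ m, (Measure.pi fun _ : Fin k => gaussianReal 0 1)
      {r | √m + 2 * √(Real.log m) < ‖(WithLp.toLp 2 r : EuclideanSpace ℝ (Fin k))‖} ≤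
        ENNReal.ofReal (1 / (m : ℝ) ^ 2) := fun k hk => by
    have h := pi_gaussianReal_norm_gt_le hk hm (t := 2 * √(Real.log m)) (by positivity)
    rw [hexp, measureReal_def] at h
    exact (ENNReal.le_ofReal_iff_toReal_le (measure_ne_top _ _) (by positivity)).2 h
  have h1 := gaussianMatrix_splitSet_compl_le (by positivity) hε (p + q) p q rfl hp hq
  refine (measure_mono fun G hG hG' => ?_).trans (h1.trans ?_)
  · exact absurd (norm_le_of_mem_splitSet hG') (not_le.2 hG)
  · rw [← ENNReal.ofReal_natCast, ← ENNReal.ofReal_mul (by positivity)]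
    refine ENNReal.ofReal_le_ofReal ?_
    -- At most `2m` steps of cost `1 / m²` add up to `2 / m`.
    have : ((p + q : ℕ) : ℝ) ≤ 2 * m := by exact_mod_cast (by omega : p + q ≤ 2 * m)
    rw [mul_one_div, div_le_div_iff₀ (by positivity) hm0]
    nlinarith

/-! ### Transfer to the random initialization and union bound over layers. -/

variable {Ω : Type*} [MeasurableSpace Ω] {μ : Measure Ω} {L : ℕ} {w : ℕ → ℕ}

theorem IsRandomInit.hasLaw_gaussianMatrix [IsProbabilityMeasure μ] {σ : ℝ} (hσ : 0 < σ)
    {θ₀ : Ω → Params L w} (h : IsRandomInit μ σ θ₀) (l : Fin L) :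
    HasLaw (fun ω i j => σ⁻¹ * (θ₀ ω).W l i j) (gaussianMatrix (w (l + 1)) (w l)) μ := by
  have hlaw : ∀ k : Fin (w (l + 1)) × Fin (w l),
      HasLaw (fun ω => σ⁻¹ * (θ₀ ω).W l k.1 k.2) (gaussianReal 0 1) μ := fun k => by
    have h1 := gaussianReal_const_mul (h.gaussian l k.1 k.2) σ⁻¹
    have h2 : NNReal.mk (σ⁻¹ ^ 2) (sq_nonneg _) * (σ ^ 2).toNNReal = 1 := by
      ext
      rw [NNReal.coe_mul, Real.coe_toNNReal _ (sq_nonneg _)]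
      change σ⁻¹ ^ 2 * σ ^ 2 = 1
      field_simp
    rw [mul_zero] at h1
    rw [← h2]
    exact h1
  have hind : iIndepFun (fun (k : Fin (w (l + 1)) × Fin (w l)) ω =>
      σ⁻¹ * (θ₀ ω).W l k.1 k.2) μ :=
    (h.indep.precomp (g := fun k : Fin (w (l + 1)) × Fin (w l) => ⟨l, k⟩)
      (fun a b hab => by simpa using hab)).comp (fun _ z => σ⁻¹ * z)
      fun _ => by fun_prop
  have hmap := (iIndepFun_iff_map_fun_eq_pi_map fun k => (hlaw k).aemeasurable).1 hind
  simp_rw [fun k => (hlaw k).map_eq] at hmap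
  have hX : AEMeasurable (fun ω (k : Fin (w (l + 1)) × Fin (w l)) => σ⁻¹ * (θ₀ ω).W l k.1 k.2) μ :=
    aemeasurable_pi_lambda _ fun k => (hlaw k).aemeasurable
  exact (measurePreserving_curry _ _).hasLaw.comp ⟨hX, hmap⟩

theorem constWidth_le {d m : ℕ} (hdm : d ≤ m) (l : ℕ) : constWidth d m l ≤ m := by
  cases l
  · exact hdm
  · exact le_rfl

theorem initStd_pos {σ₁ : ℝ} (hσ₁ : 0 < σ₁) (m : ℕ) : 0 < initStd σ₁ m := by
  unfold initStd; positivity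

/-- The calibration behind `initStd`: rescaling turns the Gaussian threshold into exactly `σ₁ * √m`.
-/
theorem initStd_mul {σ₁ : ℝ} {m : ℕ} (hm : 0 < m) :
    initStd σ₁ m * (2 * (√m + 2 * √(Real.log m))) = σ₁ * √m := by
  have hm' : 0 < √(m : ℝ) := by simpa using hm
  have h : 2 * (√(m : ℝ) + 2 * √(Real.log m)) =
      2 * (1 + 2 * √(Real.log m) / √(m : ℝ)) * √m := by field_simp
  have h0 : 2 * (1 + 2 * √(Real.log m) / √(m : ℝ)) ≠ 0 := by positivity
  rw [initStd, h, ← mul_assoc, div_mul_cancel₀ _ h0]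

theorem HoldsWithProb.mono {Ω : Type*} [MeasurableSpace Ω] {μ : Measure Ω} {p p' : ℝ}
    {P P' : Ω → Prop} (h : HoldsWithProb μ p P) (hp : p' ≤ p) (hP : ∀ ω, P ω → P' ω) :
    HoldsWithProb μ p' P' := by
  obtain ⟨A, hA, hpA, hAP⟩ := h
  exact ⟨A, hA, hp.trans hpA, fun ω hω => hP ω (hAP ω hω)⟩

variable {Ω : Type*} [MeasurableSpace Ω] {μ : Measure Ω} [IsProbabilityMeasure μ] {L d m : ℕ}

theorem IsRandomInit.measure_specNorm_gt_le (hm : 0 < m) (hdm : d ≤ m) {σ₁ : ℝ} (hσ₁ : 0 < σ₁)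
    {θ₀ : Ω → Params L (constWidth d m)} (h : IsRandomInit μ (initStd σ₁ m) θ₀) (l : Fin L) :
    μ {ω | σ₁ * √m < specNorm ((θ₀ ω).W l)} ≤ ENNReal.ofReal (2 / m) := by
  have hσ := initStd_pos hσ₁ m
  have hX := h.hasLaw_gaussianMatrix hσ l
  have hS : MeasurableSet {G : Fin (constWidth d m (l + 1)) → Fin (constWidth d m l) → ℝ |
      2 * (√m + 2 * √(Real.log m)) < ‖Matrix.of G‖} := by
    refine (isOpen_lt continuous_const ?_).measurableSet
    exact (continuous_norm (E := Matrix (Fin (constWidth d m (l + 1)))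
      (Fin (constWidth d m l)) ℝ)).comp continuous_id
  have h1 := gaussianMatrix_norm_gt_le hm (constWidth_le hdm (l + 1)) (constWidth_le hdm l)
  rw [← hX.map_eq, Measure.map_apply_of_aemeasurable hX.aemeasurable hS] at h1
  refine (measure_mono fun ω hω => ?_).trans h1
  have h2 : (Matrix.of fun i j => (initStd σ₁ m)⁻¹ * (θ₀ ω).W l i j) =
      (initStd σ₁ m)⁻¹ • (θ₀ ω).W l := rfl
  simp only [Set.mem_preimage, Set.mem_ofPred_eq] at hω ⊢
  rw [h2, norm_smul, Real.norm_of_nonneg (by positivity), lt_inv_mul_iff₀ hσ, initStd_mul hm]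
  exact hω

/-- With probability at least `1 - 2 L / m`, all hidden layers have spectral norm at most `σ₁ √m`
and the output layer is a unit vector. -/
theorem IsRandomInit.holdsWithProb_specNorm_le (hm : 0 < m) (hdm : d ≤ m) {σ₁ : ℝ} (hσ₁ : 0 < σ₁)
    {θ₀ : Ω → Params L (constWidth d m)} (h : IsRandomInit μ (initStd σ₁ m) θ₀) :
    HoldsWithProb μ (1 - 2 * (L : ℝ) / m)
      (fun ω => (∀ l, specNorm ((θ₀ ω).W l) ≤ σ₁ * √m) ∧ ‖(θ₀ ω).v‖ = 1) := by
  set E : Set Ω := (⋃ l, {ω | σ₁ * √m < specNorm ((θ₀ ω).W l)}) ∪ {ω | ¬ ‖(θ₀ ω).v‖ = 1} with hE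
  have hEle : μ E ≤ ENNReal.ofReal (2 * (L : ℝ) / m) := by
    refine (measure_union_le _ _).trans ?_
    rw [ae_iff.1 h.norm_output, add_zero]
    refine (measure_iUnion_le _).trans ?_
    rw [tsum_fintype]
    refine (Finset.sum_le_sum fun l _ => h.measure_specNorm_gt_le hm hdm hσ₁ l).trans ?_
    rw [Finset.sum_const, Finset.card_univ, Fintype.card_fin, nsmul_eq_mul,
      ← ENNReal.ofReal_natCast, ← ENNReal.ofReal_mul (by positivity)]
    exact ENNReal.ofReal_le_ofReal (le_of_eq (by ring))
  -- `E` need not be measurable, so its measurable hull, of equal measure, is removed instead.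
  have hreal : μ.real (toMeasurable μ E) ≤ 2 * (L : ℝ) / m := by
    rw [measureReal_def, measure_toMeasurable]
    exact ENNReal.toReal_le_of_le_ofReal (by positivity) hEle
  refine ⟨(toMeasurable μ E)ᶜ, (measurableSet_toMeasurable μ E).compl, ?_, fun ω hω => ?_⟩
  · rw [probReal_compl_eq_one_sub (measurableSet_toMeasurable μ E)]
    linarith
  · have hω' : ω ∉ E := fun h' => hω (subset_toMeasurable μ E h')
    simpa [hE] using hω'

end DeepNet

end

/-! ### Combination of the two bounds. -/

theorem mainTheorem10 {Ω : Type*} [MeasurableSpace Ω] (μ : Measure Ω) [IsProbabilityMeasure μ]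
    (n d m L : ℕ) (hn : 1 ≤ n) (hd : 1 ≤ d) (hdm : d ≤ m) (hL : 1 ≤ L)
    (x : Fin n → EuclideanSpace ℝ (Fin (constWidth d m 0))) (hx : ∀ i, ‖x i‖ ^ 2 = (d : ℝ))
    (y : Fin n → ℝ)
    (φ : ℝ → ℝ) (βφ : ℝ) (hφ : IsSmoothActivation φ βφ)
    (σ₁ : ℝ) (hσ₁ : 0 < σ₁)
    (θ₀ : Ω → Params L (constWidth d m)) (hθ₀ : IsRandomInit μ (initStd σ₁ m) θ₀)
    (ρ ρ₁ γ : ℝ) (hγ : γ = σ₁ + ρ / √(m : ℝ)) :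
    HoldsWithProb μ (1 - 2 * ((L : ℝ) + 1) / m)
      (fun ω => empiricalLoss squareLoss φ x y (θ₀ ω) ≤ cBound φ L y 0 σ₁) ∧
    HoldsWithProb μ (1 - 2 * ((L : ℝ) + 1) / m)
      (fun ω => ∀ θ ∈ specBall ρ ρ₁ (θ₀ ω),
        empiricalLoss squareLoss φ x y θ ≤ cBound φ L y ρ₁ γ) := by
  have hm : 0 < m := by omega
  have hm' : 0 < √(m : ℝ) := by simpa using hm
  -- The output layer is a unit vector almost surely and costs no probability, so `2 / m` is left
  -- unused.
  have hp : 1 - 2 * ((L : ℝ) + 1) / m ≤ 1 - 2 * (L : ℝ) / m := by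
    gcongr
    linarith
  have h := hθ₀.holdsWithProb_specNorm_le hm hdm hσ₁
  refine ⟨h.mono hp fun ω hω => ?_, h.mono hp fun ω hω θ hθ => ?_⟩
  · exact empiricalLoss_le_cBound hn hd hm hφ hσ₁.le (θ₀ ω) hω.1 (by rw [hω.2]; simp) x hx y
  -- A point of the ball and a first layer (`1 ≤ L`) force `0 ≤ ρ`; for negative `ρ` the claim is
  -- vacuous.
  · have hρ : 0 ≤ ρ := (specNorm_nonneg _).trans (hθ.1 ⟨0, hL⟩)
    have hγ0 : 0 ≤ γ := by rw [hγ]; positivity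
    refine empiricalLoss_le_cBound hn hd hm hφ hγ0 θ (fun l => ?_) ?_ x hx y
    · have h1 := specNorm_le_add_sub (θ.W l) ((θ₀ ω).W l)
      have h2 : γ * √m = σ₁ * √m + ρ := by rw [hγ]; field_simp
      linarith [hω.1 l, hθ.1 l]
    · have h1 := norm_le_insert' θ.v (θ₀ ω).v
      rw [hω.2] at h1
      linarith [hθ.2]
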